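/- Let $(M,g)$ be a compact smooth Riemannian manifold without boundary, let $\alpha>1$, and let $\mathbb{S}^n\subset\mathbb{R}^{n+1}$ be the unit sphere with its standard metric. For a smooth map $\psi:M\to\mathbb{S}^n$ let $|d\psi|^2$ be the squared Hilbert–Schmidt norm of its differential and let $E_\alpha(\psi)=\int_M(1+|d\psi|^2)^\alpha\,dV_g$. A smooth map $\psi$ is called $\alpha$-harmonic if it is a critical point of $E_\alpha$, i.e. $\frac{d}{dt}E_\alpha(\psi_t)|_{t=0}=0$ for every smooth variation $\psi_t$ of $\psi$. An $\alpha$-harmonic map $\psi$ is called stable if $I(\upsilon,\upsilon)\ge 0$ for every compactly supported smooth vector field $\upsilon$ along $\psi$, where $I(\upsilon,\omega)=\frac{\partial^2}{\partial t\,\partial s}E_\alpha(\psi_{t,s})|_{t=s=0}$ for a smooth two-parameter variation $\psi_{t,s}$ of $\psi=\psi_{0,0}$ with $\frac{\partial\psi_{t,s}}{\partial t}|_{t=s=0}=\upsilon$ and $\frac{\partial\psi_{t,s}}{\partial s}|_{t=s=0}=\omega$; otherwise it is called unstable. Let $\psi:M\to\mathbb{S}^n$ be an $\alpha$-harmonic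 map whose differential is not identically zero (for connected $M$: a non-constant $\alpha$-harmonic map), such that $|d\psi|^2<\dfrac{n-2}{2\alpha-n}$ everywhere on $M$. Then $\psi$ is unstable. -/

import Mathlib

open Set Filter Topology MeasureTheory
open scoped Manifold ContDiff Bundle ENNReal

noncomputable section

namespace AlphaHarmonic

/-- The model space `ℝᵐ` with its Euclidean norm. -/
abbrev Euc (m : ℕ) : Type := EuclideanSpace ℝ (Fin m)

/-- A smooth Riemannian metric on an `m`-dimensional smooth manifold (without boundary). -/
abbrev RiemMetric (m : ℕ) (M : Type*) [TopologicalSpace M] [ChartedSpace (Euc m) M]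
    [IsManifold (𝓡 m) ∞ M] : Type _ :=
  Bundle.ContMDiffRiemannianMetric (𝓡 m) ∞ (Euc m) (fun x : M => TangentSpace (𝓡 m) x)

/-- The `i`-th standard basis vector of `ℝᵐ`. -/
def stdVec {m : ℕ} (i : Fin m) : Euc m := EuclideanSpace.single i 1

/-! ### The Riemannian volume measure -/

section Volume

variable {m : ℕ} {M : Type*} [TopologicalSpace M] [ChartedSpace (Euc m) M]
  [IsManifold (𝓡 m) ∞ M]

/-- The Gram matrix `g_{ij}` of the metric in the chart centred at `x₀`, at the point of the
manifold with coordinates `y`: the `i`-th coordinate vector field is the image of the `i`-th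
standard basis vector under the derivative of the inverse chart. -/
def chartGram (g : RiemMetric m M) (x₀ : M) (y : Euc m) : Matrix (Fin m) (Fin m) ℝ :=
  Matrix.of fun i j =>
    g.inner ((chartAt (Euc m) x₀).symm y)
      (mfderiv (𝓡 m) (𝓡 m) (chartAt (Euc m) x₀).symm y (stdVec i))
      (mfderiv (𝓡 m) (𝓡 m) (chartAt (Euc m) x₀).symm y (stdVec j))

/-- The measure `√(det g_{ij}) dy¹ ⋯ dyᵐ` on the domain of the chart centred at `x₀`, as a
measure on `M` (it vanishes outside of the domain of the chart). -/
def chartVolume [MeasurableSpace M] (g : RiemMetric m M) (x₀ : M) : Measure M :=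
  Measure.map (chartAt (Euc m) x₀).symm
    ((volume.restrict (chartAt (Euc m) x₀).target).withDensity
      fun y => ENNReal.ofReal (Real.sqrt (chartGram g x₀ y).det))

variable (m M) in
/-- A smooth partition of unity subordinate to the cover of `M` by its preferred charts. -/
def chartPartition [T2Space M] [SigmaCompactSpace M] :
    SmoothPartitionOfUnity M (𝓡 m) M univ :=
  (SmoothPartitionOfUnity.exists_isSubordinate_chartAt_source (𝓡 m) M).choose

/-- The Riemannian volume measure `dV_g`, obtained by gluing the measures `√(det g_{ij}) dy` of
the charts with a partition of unity. (By the change of variables formula these measures agree on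
the overlaps of charts, so that the result does not depend on the partition of unity.) -/
def riemVolume [T2Space M] [SigmaCompactSpace M] [MeasurableSpace M] (g : RiemMetric m M) :
    Measure M :=
  Measure.sum fun x₀ : M =>
    (chartVolume g x₀).withDensity fun x => ENNReal.ofReal (chartPartition m M x₀ x)

end Volume

/-! ### The `α`-energy, its critical points, and their stability -/

section Energy

variable {m n : ℕ}
  {M : Type*} [TopologicalSpace M] [ChartedSpace (Euc m) M] [IsManifold (𝓡 m) ∞ M]
  {N : Type*} [TopologicalSpace N] [ChartedSpace (Euc n) N] [IsManifold (𝓡 n) ∞ N]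

/-- The squared Hilbert-Schmidt norm `|dψ|² = g^{ij} h(∂ᵢψ, ∂ⱼψ)` of the differential of `ψ` at
`x`, with respect to `g` and `h`. -/
def normSqDiff (g : RiemMetric m M) (h : RiemMetric n N) (ψ : M → N) (x : M) : ℝ :=
  ((Matrix.of fun i j : Fin m =>
      g.inner x (stdVec i : TangentSpace (𝓡 m) x) (stdVec j : TangentSpace (𝓡 m) x))⁻¹ *
    (Matrix.of fun i j : Fin m =>
      h.inner (ψ x) (mfderiv (𝓡 m) (𝓡 n) ψ x (stdVec i))
        (mfderiv (𝓡 m) (𝓡 n) ψ x (stdVec j)))).trace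

/-- The `α`-energy `E_α(ψ) = ∫_M (1 + |dψ|²)^α dV_g`. -/
def alphaEnergy [T2Space M] [SigmaCompactSpace M] [MeasurableSpace M]
    (g : RiemMetric m M) (h : RiemMetric n N) (α : ℝ) (ψ : M → N) : ℝ :=
  ∫ x, (1 + normSqDiff g h ψ x) ^ α ∂(riemVolume g)

variable (m n) in
/-- `Ψ : (-ε, ε) × M → N` is a smooth variation of `ψ`. -/
structure IsVariation (ψ : M → N) (ε : ℝ) (Ψ : ℝ → M → N) : Prop where
  pos : 0 < ε
  smooth : ContMDiffOn (𝓘(ℝ, ℝ).prod (𝓡 m)) (𝓡 n) ∞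
    (fun p : ℝ × M => Ψ p.1 p.2) (Ioo (-ε) ε ×ˢ univ)
  zero : Ψ 0 = ψ

/-- `ψ` is `α`-harmonic: it is smooth, and a critical point of the `α`-energy. -/
def IsAlphaHarmonic [T2Space M] [SigmaCompactSpace M] [MeasurableSpace M]
    (g : RiemMetric m M) (h : RiemMetric n N) (α : ℝ) (ψ : M → N) : Prop :=
  ContMDiff (𝓡 m) (𝓡 n) ∞ ψ ∧
    ∀ (ε : ℝ) (Ψ : ℝ → M → N), IsVariation m n ψ ε Ψ →
      HasDerivAt (fun t => alphaEnergy g h α (Ψ t)) 0 0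

variable (m n) in
/-- `υ` is a smooth, compactly supported vector field along `ψ`, that is, a smooth section of
`ψ⁻¹TN` with compact support. -/
structure IsVectorFieldAlong (ψ : M → N) (υ : ∀ x, TangentSpace (𝓡 n) (ψ x)) : Prop where
  smooth : ContMDiff (𝓡 m) (𝓡 n).tangent ∞
    (fun x => (⟨ψ x, υ x⟩ : TangentBundle (𝓡 n) N))
  compact_support : IsCompact (closure {x | υ x ≠ 0})

variable (m n) in
/-- `Ψ : (-ε, ε) × (-ε, ε) × M → N`, `(t, s, x) ↦ ψ_{t,s}(x)`, is a smooth two-parameter variation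
of `ψ` with `∂ψ_{t,s}/∂t = υ` and `∂ψ_{t,s}/∂s = w` at `t = s = 0`. -/
structure IsVariation₂ (ψ : M → N) (υ w : ∀ x, TangentSpace (𝓡 n) (ψ x))
    (ε : ℝ) (Ψ : ℝ → ℝ → M → N) : Prop where
  pos : 0 < ε
  smooth : ContMDiffOn (𝓘(ℝ, ℝ).prod (𝓘(ℝ, ℝ).prod (𝓡 m))) (𝓡 n) ∞
    (fun p : ℝ × ℝ × M => Ψ p.1 p.2.1 p.2.2) (Ioo (-ε) ε ×ˢ (Ioo (-ε) ε ×ˢ univ))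
  zero : Ψ 0 0 = ψ
  deriv_t : ∀ x, (⟨Ψ 0 0 x, mfderiv 𝓘(ℝ, ℝ) (𝓡 n) (fun t => Ψ t 0 x) 0 (1 : ℝ)⟩ :
    TangentBundle (𝓡 n) N) = ⟨ψ x, υ x⟩
  deriv_s : ∀ x, (⟨Ψ 0 0 x, mfderiv 𝓘(ℝ, ℝ) (𝓡 n) (fun s => Ψ 0 s x) 0 (1 : ℝ)⟩ :
    TangentBundle (𝓡 n) N) = ⟨ψ x, w x⟩

/-- The second derivative `∂²/∂t∂s E_α(ψ_{t,s})` at `t = s = 0`. -/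
def secondVariation [T2Space M] [SigmaCompactSpace M] [MeasurableSpace M]
    (g : RiemMetric m M) (h : RiemMetric n N) (α : ℝ) (Ψ : ℝ → ℝ → M → N) : ℝ :=
  deriv (fun t => deriv (fun s => alphaEnergy g h α (Ψ t s)) 0) 0

/-- An `α`-harmonic map `ψ` is stable if `I(υ, υ) ≥ 0` for all compactly supported vector fields
`υ` along `ψ`, where `I(υ, w)` is the second derivative `∂²/∂t∂s E_α(ψ_{t,s})` at `t = s = 0` for
a two-parameter variation of `ψ` with velocities `υ` and `w`. (At an `α`-harmonic map, this second
derivative depends only on `υ` and `w`.) -/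
def IsStable [T2Space M] [SigmaCompactSpace M] [MeasurableSpace M]
    (g : RiemMetric m M) (h : RiemMetric n N) (α : ℝ) (ψ : M → N) : Prop :=
  ∀ υ : ∀ x, TangentSpace (𝓡 n) (ψ x), IsVectorFieldAlong m n ψ υ →
    ∀ (ε : ℝ) (Ψ : ℝ → ℝ → M → N), IsVariation₂ m n ψ υ υ ε Ψ →
      0 ≤ secondVariation g h α Ψ

end Energy

/-! ### The standard unit sphere -/

section Sphere

/-- The unit sphere `𝕊ⁿ` in `ℝⁿ⁺¹`. -/
abbrev Sphere (n : ℕ) : Type := Metric.sphere (0 : Euc (n + 1)) 1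

/-- The derivative of the inclusion `𝕊ⁿ → ℝⁿ⁺¹`. -/
def inclDeriv {n : ℕ} (p : Sphere n) : Euc n →L[ℝ] Euc (n + 1) :=
  mfderiv (𝓡 n) 𝓘(ℝ, Euc (n + 1)) (fun q : Sphere n => (q : Euc (n + 1))) p

/-- The bilinear form `(v, w) ↦ ⟨A v, A w⟩`. -/
def pullInner {n : ℕ} (A : Euc n →L[ℝ] Euc (n + 1)) : Euc n →L[ℝ] Euc n →L[ℝ] ℝ :=
  ((ContinuousLinearMap.compL ℝ (Euc n) (Euc (n + 1)) ℝ).flip A).comp ((innerSL ℝ).comp A)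

lemma pullInner_apply {n : ℕ} (A : Euc n →L[ℝ] Euc (n + 1)) (v w : Euc n) :
    pullInner A v w = inner ℝ (A v) (A w) := rfl

lemma inclDeriv_injective {n : ℕ} (p : Sphere n) : Function.Injective (inclDeriv p) :=
  haveI := Fact.mk (finrank_euclideanSpace_fin (𝕜 := ℝ) (n := n + 1))
  by convert! injective_mvfderiv_subtypeVal_sphere p

/-- The inner product `⟨v, w⟩` of tangent vectors of `𝕊ⁿ ⊆ ℝⁿ⁺¹`. -/
def roundInner {n : ℕ} (p : Sphere n) :
    TangentSpace (𝓡 n) p →L[ℝ] TangentSpace (𝓡 n) p →L[ℝ] ℝ :=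
  pullInner (inclDeriv p)

/-- The standard Riemannian metric of `𝕊ⁿ`, induced by the inclusion into `ℝⁿ⁺¹`. -/
def roundMetric (n : ℕ) : RiemMetric n (Sphere n) where
  inner p := roundInner p
  symm p v w := real_inner_comm (inclDeriv p w) (inclDeriv p v)
  pos p v hv := by
    refine (real_inner_self_pos (F := Euc (n + 1))).2 fun h => hv ?_
    exact inclDeriv_injective p (h.trans (map_zero (inclDeriv p)).symm)
  isVonNBounded p := by
    obtain ⟨K, hK, hb⟩ :=
      (inclDeriv p).toLinearMap.exists_antilipschitzWith
        (LinearMap.ker_eq_bot.2 (inclDeriv_injective p))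
    change Bornology.IsVonNBounded ℝ {v : Euc n | inner ℝ (inclDeriv p v) (inclDeriv p v) < 1}
    refine (NormedSpace.isVonNBounded_closedBall ℝ (Euc n) K).subset fun v hv => ?_
    have h1 : ‖inclDeriv p v‖ ^ 2 < 1 := by
      rw [← real_inner_self_eq_norm_sq]; exact hv
    have h2 : ‖inclDeriv p v‖ ≤ 1 := by nlinarith [norm_nonneg (inclDeriv p v)]
    have h3 : ‖v‖ ≤ K * ‖inclDeriv p v‖ := by
      simpa [dist_zero_right] using hb.le_mul_dist v 0
    rw [mem_closedBall_zero_iff]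
    nlinarith [NNReal.coe_nonneg K]
  contMDiff := by
    intro p
    refine (Bundle.contMDiffAt_section _).2 ?_
    have hsm : ContMDiff (𝓡 n) 𝓘(ℝ, Euc (n + 1)) ω (fun q : Sphere n => (q : Euc (n + 1))) :=
      haveI := Fact.mk (finrank_euclideanSpace_fin (𝕜 := ℝ) (n := n + 1))
      contMDiff_coe_sphere
    have hA := (hsm p).mfderiv_const (m := ∞) (by simp)
    have hB : ContMDiffAt (𝓡 n) 𝓘(ℝ, Euc n →L[ℝ] Euc n →L[ℝ] ℝ) ∞
        (fun q => pullInner (inTangentCoordinates (𝓡 n) 𝓘(ℝ, Euc (n + 1)) id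
          (fun q : Sphere n => (q : Euc (n + 1))) inclDeriv p q)) p := by
      have h2 : ContDiff ℝ ∞ (pullInner (n := n)) := by
        unfold pullInner
        fun_prop
      exact h2.contMDiff.contMDiffAt.comp p hA
    refine hB.congr_of_eventuallyEq ?_
    have hp : (trivializationAt (Euc n) (TangentSpace (𝓡 n)) p).baseSet ∈ 𝓝 p :=
      (trivializationAt (Euc n) (TangentSpace (𝓡 n)) p).open_baseSet.mem_nhds
        (FiberBundle.mem_baseSet_trivializationAt' p)
    filter_upwards [hp] with q hq
    ext v w
    rw [hom_trivializationAt_apply]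
    dsimp only
    rw [inCoordinates_apply_eq₂ hq hq (Set.mem_univ _)]
    have key : ∀ u : Euc n, inTangentCoordinates (𝓡 n) 𝓘(ℝ, Euc (n + 1)) id
        (fun q : Sphere n => (q : Euc (n + 1))) inclDeriv p q u =
        inclDeriv q ((trivializationAt (Euc n) (TangentSpace (𝓡 n)) p).symm q u) := by
      intro u
      unfold inTangentCoordinates ContinuousLinearMap.inCoordinates
      erw [TangentBundle.continuousLinearMapAt_model_space]
      change inclDeriv q (Bundle.Trivialization.symmL ℝ
        (trivializationAt (Euc n) (TangentSpace (𝓡 n)) p) q u) = _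
      rw [Bundle.Trivialization.symmL_apply _ hq]
    rw [pullInner_apply, key, key]
    simp
    rfl

end Sphere

end AlphaHarmonic

end

/-!
The sphere has many conformal diffeomorphisms. For a unit vector `V` of `ℝⁿ⁺¹`, the boosts
`F_r` along `V` form the flow of the tangential projection of `V`, and
`F_r^* h = (cosh r + ⟨V, p⟩ sinh r)⁻² h` (`inner_fderiv_boostAux`). Writing `e = |dψ|²` and
`u = ⟨V, ψ⟩`, this gives the `α`-energy along the variation `F_{t + s} ∘ ψ` in closed form,
`E_α(F_r ∘ ψ) = ∫ (1 + e / (cosh r + u sinh r)²)^α` (`alphaEnergy_boost`), and its second derivative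
at `r = 0` is the second variation in the direction of the projected `V` (`secondVariation_boost`):
`∫ 2α (1 + e)^(α - 2) e (2 (α - 1) e u² + (1 + e) (3u² - 1))`.

Summing over an orthonormal basis of vectors `V`, where `∑ u² = |ψ|² = 1`, yields
`-∫ 2α (1 + e)^(α - 2) e ((n - 2) - (2α - n) e)` (`sum_boostIntegrandDeriv₂_zero`). The bound on `e`
makes the integrand nonnegative, and positive where `dψ ≠ 0`, so one of the basis vectors is a
direction of negative second variation (`exists_integral_boostIntegrandDeriv₂_neg`).

The analytic input is that the Riemannian volume of a compact manifold is finite and charges every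
nonempty open set (`isFiniteMeasure_riemVolume`, `riemVolume_pos_of_isOpen`), and that `|dψ|²` is
continuous (`continuous_energyDensity`). The latter needs an argument because `normSqDiff` is
expressed at each point in the preferred chart of that point; invariance of the trace under changes
of basis allows a fixed chart to be used near each point (`energyDensity_chart`).
-/

noncomputable section

namespace AlphaHarmonic

/-! ### Conformal boosts of the sphere -/

section Boost

variable {F : Type*} [NormedAddCommGroup F] [InnerProductSpace ℝ F]

/-- The reciprocal `cosh r + ⟨V, p⟩ sinh r` of the conformal factor of the boost. -/
def boostDen (V : F) (r : ℝ) (p : F) : ℝ := Real.cosh r + Real.sinh r * inner ℝ V p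

/-- The boost with rapidity `r` along the unit vector `V`, as a map of the ambient space: with
`u = ⟨V, p⟩`, `p ↦ (p + ((cosh r - 1) u + sinh r) V) / (cosh r + u sinh r)`. On the unit sphere this
is the time-`r` flow of the tangential projection of `V`. Only its values near the sphere matter;
elsewhere the denominator may vanish. -/
def boostAux (V : F) (r : ℝ) (p : F) : F :=
  (boostDen V r p)⁻¹ • (p + ((Real.cosh r - 1) * inner ℝ V p + Real.sinh r) • V)

lemma cosh_add_sinh_mul_pos {u : ℝ} (hu : |u| ≤ 1) (r : ℝ) :
    0 < Real.cosh r + Real.sinh r * u := by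
  obtain ⟨h1, h2⟩ := abs_le.1 hu
  have hp : 0 < Real.cosh r + Real.sinh r := by rw [Real.cosh_add_sinh]; positivity
  have hm : 0 < Real.cosh r - Real.sinh r := by rw [Real.cosh_sub_sinh]; positivity
  rcases h2.lt_or_eq with h | h <;> nlinarith

lemma abs_inner_le_one {V p : F} (hV : ‖V‖ = 1) (hp : ‖p‖ = 1) : |(inner ℝ V p : ℝ)| ≤ 1 := by
  simpa [hV, hp] using abs_real_inner_le_norm V p

lemma boostDen_pos {V p : F} (hV : ‖V‖ = 1) (hp : ‖p‖ = 1) (r : ℝ) : 0 < boostDen V r p :=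
  cosh_add_sinh_mul_pos (abs_inner_le_one hV hp) r

lemma norm_boostAux {V p : F} (hV : ‖V‖ = 1) (hp : ‖p‖ = 1) (r : ℝ) :
    ‖boostAux V r p‖ = 1 := by
  have hD := boostDen_pos hV hp r
  -- On the sphere, the numerator of the boost has the same length as the denominator.
  have key : ‖p + ((Real.cosh r - 1) * inner ℝ V p + Real.sinh r) • V‖ ^ 2 =
      boostDen V r p ^ 2 := by
    rw [norm_add_sq_real, norm_smul, mul_pow, hV, hp, inner_smul_right, real_inner_comm V p,
      boostDen, Real.norm_eq_abs, sq_abs]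
    linear_combination ((inner ℝ V p) ^ 2 - 1 : ℝ) * Real.cosh_sq r
  rw [sq_eq_sq₀ (norm_nonneg _) hD.le] at key
  rw [boostAux, norm_smul, key, norm_inv, Real.norm_eq_abs, abs_of_pos hD, inv_mul_cancel₀ hD.ne']

lemma boostAux_zero (V p : F) : boostAux V 0 p = p := by
  simp [boostAux, boostDen]

/-- The boosts are conformal on the unit sphere, with factor `(cosh r + ⟨V, p⟩ sinh r)⁻¹`. -/
lemma inner_fderiv_boostAux {V p : F} (hV : ‖V‖ = 1) (hp : ‖p‖ = 1) (r : ℝ) {v w : F}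
    (hv : inner ℝ p v = 0) (hw : inner ℝ p w = 0) :
    inner ℝ (fderiv ℝ (boostAux V r) p v) (fderiv ℝ (boostAux V r) p w) =
      (boostDen V r p ^ 2)⁻¹ * (inner ℝ v w : ℝ) := by
  have hD := (boostDen_pos hV hp r).ne'
  have h1 : HasFDerivAt (fun q : F => (inner ℝ V q : ℝ)) (innerSL ℝ V) p :=
    (innerSL ℝ V).hasFDerivAt
  have h2 : HasFDerivAt (boostDen V r) (Real.sinh r • innerSL ℝ V) p :=
    (h1.const_mul (Real.sinh r)).const_add (Real.cosh r)
  have h3 := (hasFDerivAt_id p).add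
    (((h1.const_mul (Real.cosh r - 1)).add_const (Real.sinh r)).smul_const V)
  have h4 := ((hasDerivAt_inv hD).comp_hasFDerivAt p h2).smul h3
  have h5 : ∀ x, fderiv ℝ (boostAux V r) p x = (boostDen V r p)⁻¹ •
      (x + ((Real.cosh r - 1) * inner ℝ V x) • V) -
      ((boostDen V r p ^ 2)⁻¹ * (Real.sinh r * inner ℝ V x)) •
        (p + ((Real.cosh r - 1) * inner ℝ V p + Real.sinh r) • V) := by
    intro x
    have h6 : fderiv ℝ (boostAux V r) p = _ := HasFDerivAt.fderiv h4
    rw [h6]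
    simp [sub_eq_add_neg, add_comm]
  rw [h5, h5]
  have hVV : inner ℝ V V = (1 : ℝ) := by simp [hV]
  have hpp : inner ℝ p p = (1 : ℝ) := by simp [hp]
  have hv' : inner ℝ v p = (0 : ℝ) := by rw [real_inner_comm, hv]
  simp only [inner_add_left, inner_add_right, inner_sub_left, inner_sub_right, inner_smul_left,
    inner_smul_right, hVV, hpp, hw, hv', real_inner_comm V p, real_inner_comm V v,
    RCLike.conj_to_real]
  have hc := Real.cosh_sq r
  set c := Real.cosh r
  set s := Real.sinh r
  have hDdef : boostDen V r p = c + s * inner ℝ V p := rfl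
  set D := boostDen V r p
  generalize (inner ℝ V p : ℝ) = u at *
  generalize (inner ℝ V v : ℝ) = a
  generalize (inner ℝ V w : ℝ) = b
  generalize (inner ℝ v w : ℝ) = e
  field_simp
  rw [hDdef]
  -- The two sides differ by a multiple of `cosh² - sinh² - 1`.
  linear_combination a * b * ((c + s * u) ^ 2 - 2 * (c + s * u) * s * u + s ^ 2 * (u ^ 2 - 1)) * hc

lemma contDiff_boostDen (V : F) : ContDiff ℝ ∞ (fun q : ℝ × F => boostDen V q.1 q.2) :=
  (Real.contDiff_cosh.comp contDiff_fst).add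
    ((Real.contDiff_sinh.comp contDiff_fst).mul (contDiff_const.inner ℝ contDiff_snd))

lemma contDiffAt_boostAux {V p : F} (hV : ‖V‖ = 1) (hp : ‖p‖ = 1) (r : ℝ) :
    ContDiffAt ℝ ∞ (fun q : ℝ × F => boostAux V q.1 q.2) (r, p) := by
  refine ContDiffAt.smul (ContDiffAt.inv (contDiff_boostDen V).contDiffAt
    (boostDen_pos hV hp r).ne') (ContDiff.contDiffAt ?_)
  exact contDiff_snd.add (((((Real.contDiff_cosh.comp contDiff_fst).sub contDiff_const).mul
    (contDiff_const.inner ℝ contDiff_snd)).add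
      (Real.contDiff_sinh.comp contDiff_fst)).smul contDiff_const)

lemma differentiableAt_boostAux {V p : F} (hV : ‖V‖ = 1) (hp : ‖p‖ = 1) (r : ℝ) :
    DifferentiableAt ℝ (boostAux V r) p :=
  ((contDiffAt_boostAux hV hp r).differentiableAt (by simp)).comp p
    ((differentiableAt_const r).prodMk differentiableAt_id)

end Boost

variable {n : ℕ}

/-- The boost with rapidity `r` along the unit vector `V`, as a map of the unit sphere. -/
def boost (V : Euc (n + 1)) (hV : ‖V‖ = 1) (r : ℝ) (p : Sphere n) : Sphere n :=
  ⟨boostAux V r p, by simpa using norm_boostAux hV (norm_eq_of_mem_sphere p) r⟩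

@[simp] lemma coe_boost (V : Euc (n + 1)) (hV : ‖V‖ = 1) (r : ℝ) (p : Sphere n) :
    (boost V hV r p : Euc (n + 1)) = boostAux V r p := rfl

lemma boost_zero (V : Euc (n + 1)) (hV : ‖V‖ = 1) (p : Sphere n) : boost V hV 0 p = p :=
  Subtype.ext (boostAux_zero V _)

lemma contMDiff_sphere_incl : ContMDiff (𝓡 n) 𝓘(ℝ, Euc (n + 1)) ∞
    (fun q : Sphere n => (q : Euc (n + 1))) :=
  have := Fact.mk (finrank_euclideanSpace_fin (𝕜 := ℝ) (n := n + 1))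
  contMDiff_coe_sphere

lemma contMDiff_prodMk_sphere_incl : ContMDiff (𝓘(ℝ, ℝ).prod (𝓡 n)) 𝓘(ℝ, ℝ × Euc (n + 1)) ∞
    (fun q : ℝ × Sphere n => (q.1, (q.2 : Euc (n + 1)))) :=
  contMDiff_fst.prodMk_space (contMDiff_sphere_incl.comp contMDiff_snd)

lemma contMDiff_coe_boost (V : Euc (n + 1)) (hV : ‖V‖ = 1) :
    ContMDiff (𝓘(ℝ, ℝ).prod (𝓡 n)) 𝓘(ℝ, Euc (n + 1)) ∞
      (fun q : ℝ × Sphere n => boostAux V q.1 (q.2 : Euc (n + 1))) := fun q => by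
  have h2 : ContMDiffAt 𝓘(ℝ, ℝ × Euc (n + 1)) 𝓘(ℝ, Euc (n + 1)) ∞
      (fun q : ℝ × Euc (n + 1) => boostAux V q.1 q.2) (q.1, (q.2 : Euc (n + 1))) :=
    ContDiffAt.contMDiffAt (contDiffAt_boostAux hV (norm_eq_of_mem_sphere q.2) q.1)
  have h1 := contMDiff_prodMk_sphere_incl q
  have h3 := ContMDiffAt.comp (g := fun q : ℝ × Euc (n + 1) => boostAux V q.1 q.2)
    (f := fun q : ℝ × Sphere n => (q.1, (q.2 : Euc (n + 1)))) q h2 h1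
  exact h3

lemma contMDiff_boost (V : Euc (n + 1)) (hV : ‖V‖ = 1) :
    ContMDiff (𝓘(ℝ, ℝ).prod (𝓡 n)) (𝓡 n) ∞ (fun q : ℝ × Sphere n => boost V hV q.1 q.2) :=
  have := Fact.mk (finrank_euclideanSpace_fin (𝕜 := ℝ) (n := n + 1))
  (contMDiff_coe_boost V hV).codRestrict_sphere fun q => (boost V hV q.1 q.2).2

/-! ### Traces of Gram matrices -/

section Gram

open Matrix

variable {m k : ℕ}

/-- The Gram matrix of a bilinear form on `ℝᵐ` in the standard basis. -/
def gram (B : Euc m →L[ℝ] Euc m →L[ℝ] ℝ) : Matrix (Fin m) (Fin m) ℝ :=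
  Matrix.of fun i j => B (stdVec i) (stdVec j)

/-- The matrix of a linear map `ℝᵐ → ℝᵏ` in the standard bases. -/
def stdMatrix (P : Euc m →L[ℝ] Euc k) : Matrix (Fin k) (Fin m) ℝ :=
  Matrix.of fun i j => P (stdVec j) i

/-- The pullback of the Euclidean inner product by a linear map. -/
def pullForm (A : Euc m →L[ℝ] Euc k) : Euc m →L[ℝ] Euc m →L[ℝ] ℝ :=
  (innerSL ℝ).bilinearComp A A

lemma pullForm_apply (A : Euc m →L[ℝ] Euc k) (v w : Euc m) :
    pullForm A v w = inner ℝ (A v) (A w) := rfl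

lemma sum_smul_stdVec (v : Euc m) : ∑ i, v i • stdVec i = v := by
  ext j
  simp [stdVec, Finset.sum_apply, Pi.single_apply]

lemma bilin_eq_dotProduct (B : Euc m →L[ℝ] Euc m →L[ℝ] ℝ) (v w : Euc m) :
    B v w = v.ofLp ⬝ᵥ (gram B *ᵥ w.ofLp) := by
  conv_lhs => rw [← sum_smul_stdVec v, ← sum_smul_stdVec w]
  simp only [map_sum, map_smul, _root_.sum_apply, _root_.smul_apply,
    smul_eq_mul, dotProduct, mulVec, gram, Matrix.of_apply, Finset.mul_sum]
  rw [Finset.sum_comm]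
  refine Finset.sum_congr rfl fun i _ => Finset.sum_congr rfl fun j _ => by ring

lemma posDef_gram {B : Euc m →L[ℝ] Euc m →L[ℝ] ℝ} (hs : ∀ v w, B v w = B w v)
    (hp : ∀ v, v ≠ 0 → 0 < B v v) : (gram B).PosDef := by
  refine .of_dotProduct_mulVec_pos (by ext i j; simp [gram, hs]) fun x hx => ?_
  have := hp (WithLp.toLp 2 x) (by simpa using hx)
  rwa [bilin_eq_dotProduct] at this

lemma stdMatrix_mulVec (P : Euc m →L[ℝ] Euc k) (v : Fin m → ℝ) :
    stdMatrix P *ᵥ v = (P (WithLp.toLp 2 v)).ofLp := by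
  conv_rhs => rw [← sum_smul_stdVec (WithLp.toLp 2 v)]
  ext i
  simp [map_sum, mulVec, dotProduct, stdMatrix, mul_comm, Finset.sum_apply]

lemma gram_bilinearComp (B : Euc m →L[ℝ] Euc m →L[ℝ] ℝ) (P : Euc m →L[ℝ] Euc m) :
    gram (B.bilinearComp P P) = (stdMatrix P)ᵀ * gram B * stdMatrix P := by
  ext i j
  change B (P (stdVec i)) (P (stdVec j)) = _
  rw [bilin_eq_dotProduct, Matrix.mul_assoc, Matrix.mul_apply]
  rfl

lemma isUnit_stdMatrix {P : Euc m →L[ℝ] Euc m} (hP : Function.Injective P) :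
    IsUnit (stdMatrix P) := by
  rw [← Matrix.mulVec_injective_iff_isUnit]
  intro v w h
  rw [stdMatrix_mulVec, stdMatrix_mulVec] at h
  exact congrArg WithLp.ofLp (hP (WithLp.ofLp_injective 2 h))

/-- The trace of one bilinear form with respect to another does not depend on the basis. -/
lemma trace_gram_inv_mul_bilinearComp (B B' : Euc m →L[ℝ] Euc m →L[ℝ] ℝ) {P : Euc m →L[ℝ] Euc m}
    (hP : Function.Injective P) :
    ((gram (B.bilinearComp P P))⁻¹ * gram (B'.bilinearComp P P)).trace =
      ((gram B)⁻¹ * gram B').trace := by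
  have hu := (Matrix.isUnit_iff_isUnit_det _).1 (isUnit_stdMatrix hP)
  have hu' : IsUnit (stdMatrix P)ᵀ.det := by rwa [Matrix.det_transpose]
  rw [gram_bilinearComp, gram_bilinearComp, Matrix.mul_inv_rev, Matrix.mul_inv_rev,
    Matrix.mul_assoc, Matrix.mul_assoc, ← Matrix.mul_assoc ((stdMatrix P)ᵀ⁻¹),
    ← Matrix.mul_assoc ((stdMatrix P)ᵀ⁻¹), Matrix.nonsing_inv_mul _ hu', Matrix.one_mul,
    Matrix.trace_mul_comm, Matrix.mul_assoc, Matrix.mul_assoc, Matrix.mul_nonsing_inv _ hu,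
    Matrix.mul_one]

lemma gram_pullForm (A : Euc m →L[ℝ] Euc k) :
    gram (pullForm A) = (stdMatrix A)ᵀ * stdMatrix A := by
  ext i j
  simp [gram, pullForm_apply, PiLp.inner_apply, Matrix.mul_apply, stdMatrix, mul_comm]

/-- Written over the rows of the matrix of `A`, the trace is a sum of values of the quadratic form
`G⁻¹`; this avoids square roots of `G`. -/
lemma trace_gram_inv_mul_pullForm (G : Matrix (Fin m) (Fin m) ℝ) (A : Euc m →L[ℝ] Euc k) :
    (G⁻¹ * gram (pullForm A)).trace = ∑ i, stdMatrix A i ⬝ᵥ (G⁻¹ *ᵥ stdMatrix A i) := by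
  rw [gram_pullForm, ← Matrix.mul_assoc, Matrix.trace_mul_comm, Matrix.trace]
  rfl

lemma trace_gram_inv_mul_pullForm_nonneg {G : Matrix (Fin m) (Fin m) ℝ} (hG : G.PosDef)
    (A : Euc m →L[ℝ] Euc k) : 0 ≤ (G⁻¹ * gram (pullForm A)).trace := by
  rw [trace_gram_inv_mul_pullForm]
  exact Finset.sum_nonneg fun i _ => hG.inv.posSemidef.dotProduct_mulVec_nonneg _

lemma trace_gram_inv_mul_pullForm_pos {G : Matrix (Fin m) (Fin m) ℝ} (hG : G.PosDef)
    {A : Euc m →L[ℝ] Euc k} (hA : A ≠ 0) : 0 < (G⁻¹ * gram (pullForm A)).trace := by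
  rw [trace_gram_inv_mul_pullForm]
  refine Finset.sum_pos' (fun i _ => hG.inv.posSemidef.dotProduct_mulVec_nonneg _) ?_
  by_contra! h
  refine hA (ContinuousLinearMap.ext fun v => ?_)
  have h0 : stdMatrix A = 0 := by
    refine funext fun i => by_contra fun hi => ?_
    exact (hG.inv.dotProduct_mulVec_pos hi).not_ge (h i (Finset.mem_univ i))
  have := stdMatrix_mulVec A v.ofLp
  rw [h0, Matrix.zero_mulVec] at this
  exact WithLp.ofLp_injective 2 this.symm

end Gram

/-! ### The energy density -/

section NormSqDiff

variable {m n k : ℕ}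
  {M : Type*} [TopologicalSpace M] [ChartedSpace (Euc m) M]

/-- The differential of a map into a Euclidean space, as a linear map between model spaces. -/
def ambDeriv (f : M → Euc k) (x : M) : Euc m →L[ℝ] Euc k := mfderiv (𝓡 m) 𝓘(ℝ, Euc k) f x

lemma ambDeriv_coe_sphere {ψ : M → Sphere n} {x : M}
    (hψ : MDifferentiableAt (𝓡 m) (𝓡 n) ψ x) (v : Euc m) :
    ambDeriv (fun x => (ψ x : Euc (n + 1))) x v =
      inclDeriv (ψ x) (mfderiv (𝓡 m) (𝓡 n) ψ x v) := by
  have h := mfderiv_comp x ((contMDiff_sphere_incl (n := n)).mdifferentiable (by simp) (ψ x)) hψ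
  exact congrArg (fun A : Euc m →L[ℝ] Euc (n + 1) => A v) h

lemma ambDeriv_coe_sphere_ne_zero {ψ : M → Sphere n} {x : M}
    (hψ : MDifferentiableAt (𝓡 m) (𝓡 n) ψ x) (h : mfderiv (𝓡 m) (𝓡 n) ψ x ≠ 0) :
    ambDeriv (m := m) (fun x => (ψ x : Euc (n + 1))) x ≠ 0 := by
  contrapose! h
  ext1 v
  have := ambDeriv_coe_sphere hψ v
  rw [h] at this
  exact inclDeriv_injective (ψ x) (this.symm.trans (map_zero (inclDeriv (ψ x))).symm)

lemma inner_ambDeriv_coe_sphere {ψ : M → Sphere n} {x : M}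
    (hψ : MDifferentiableAt (𝓡 m) (𝓡 n) ψ x) (v : Euc m) :
    inner ℝ (ψ x : Euc (n + 1)) (ambDeriv (fun x => (ψ x : Euc (n + 1))) x v) = 0 := by
  have := Fact.mk (finrank_euclideanSpace_fin (𝕜 := ℝ) (n := n + 1))
  rw [ambDeriv_coe_sphere hψ]
  have h : inclDeriv (ψ x) (mfderiv (𝓡 m) (𝓡 n) ψ x v) ∈ (ℝ ∙ (ψ x : Euc (n + 1)))ᗮ := by
    rw [← range_mvfderiv_subtypeVal (n := n) (ψ x)]
    exact ⟨_, rfl⟩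
  exact Submodule.mem_orthogonal_singleton_iff_inner_right.1 h

variable [IsManifold (𝓡 m) ∞ M]

/-- The metric at a point, as a bilinear form on the model space `ℝᵐ`, which is the tangent space
by definition. -/
def metricForm (g : RiemMetric m M) (x : M) : Euc m →L[ℝ] Euc m →L[ℝ] ℝ := g.inner x

/-- The derivative of the inverse of the chart centred at `x₀`; it maps the standard basis to the
coordinate vector fields of the chart. -/
def chartFrame (x₀ : M) (y : Euc m) : Euc m →L[ℝ] Euc m :=
  mfderiv (𝓡 m) (𝓡 m) (chartAt (Euc m) x₀).symm y

lemma posDef_gram_metricForm_comp (g : RiemMetric m M) (x : M) {P : Euc m →L[ℝ] Euc m}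
    (hP : Function.Injective P) : (gram ((metricForm g x).bilinearComp P P)).PosDef :=
  posDef_gram (fun v w => g.symm x (P v) (P w)) fun v hv =>
    g.pos x (P v) fun h => hv (hP (h.trans (map_zero P).symm))

lemma posDef_gram_metricForm (g : RiemMetric m M) (x : M) : (gram (metricForm g x)).PosDef :=
  posDef_gram (g.symm x) (g.pos x)

lemma chartFrame_injective (x₀ : M) {y : Euc m} (hy : y ∈ (chartAt (Euc m) x₀).target) :
    Function.Injective (chartFrame x₀ y) :=
  (mdifferentiable_chart (I := 𝓡 m) x₀).symm.mfderiv_injective hy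

lemma chartGram_eq_gram (g : RiemMetric m M) (x₀ : M) (y : Euc m) :
    chartGram g x₀ y = gram ((metricForm g ((chartAt (Euc m) x₀).symm y)).bilinearComp
      (chartFrame x₀ y) (chartFrame x₀ y)) := rfl

lemma posDef_chartGram (g : RiemMetric m M) (x₀ : M) {y : Euc m}
    (hy : y ∈ (chartAt (Euc m) x₀).target) : (chartGram g x₀ y).PosDef :=
  posDef_gram_metricForm_comp g _ (chartFrame_injective x₀ hy)

lemma continuousOn_chartFrame (x₀ : M) (v : Euc m) :
    ContinuousOn (fun y => (⟨(chartAt (Euc m) x₀).symm y, chartFrame x₀ y v⟩ :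
      TangentBundle (𝓡 m) M)) (chartAt (Euc m) x₀).target := by
  have ho := (chartAt (Euc m) x₀).open_target
  have h1 := (contMDiffOn_chart_symm (I := 𝓡 m) (n := ∞) (x := x₀)).continuousOn_tangentMapWithin
    (by simp) ho.uniqueMDiffOn
  have h2 : Continuous (fun y : Euc m => (⟨y, v⟩ : TangentBundle (𝓡 m) (Euc m))) :=
    (tangentBundleModelSpaceHomeomorph (𝓡 m)).symm.continuous.comp
      (f := fun y : Euc m => ((y, v) : ModelProd (Euc m) (Euc m)))
      (continuous_id.prodMk continuous_const)
  refine (h1.comp h2.continuousOn fun y hy => hy).congr fun y hy => ?_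
  exact (tangentMapWithin_eq_tangentMap (p := (⟨y, v⟩ : TangentBundle (𝓡 m) (Euc m)))
    (ho.uniqueMDiffOn y hy)
    ((mdifferentiable_chart (I := 𝓡 m) x₀).mdifferentiableAt_symm hy)).symm

lemma continuousOn_chartGram (g : RiemMetric m M) (x₀ : M) :
    ContinuousOn (chartGram g x₀) (chartAt (Euc m) x₀).target := by
  refine continuousOn_pi.2 fun i => continuousOn_pi.2 fun j => ?_
  have h := (g.contMDiff.continuous.comp_continuousOn
    (chartAt (Euc m) x₀).continuousOn_symm).clm_bundle_apply₂ (F₁ := Euc m) (F₂ := Euc m)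
    (E₃ := Bundle.Trivial M ℝ) (F₃ := ℝ)
    (continuousOn_chartFrame x₀ (stdVec i)) (continuousOn_chartFrame x₀ (stdVec j))
  intro y hy
  have h' := h y hy
  simp only [FiberBundle.continuousWithinAt_totalSpace] at h'
  exact h'.2

lemma ambDeriv_comp_chart {f : M → Euc k} (x₀ : M) {y : Euc m}
    (hy : y ∈ (chartAt (Euc m) x₀).target)
    (hf : MDifferentiableAt (𝓡 m) 𝓘(ℝ, Euc k) f ((chartAt (Euc m) x₀).symm y)) :
    fderiv ℝ (f ∘ (chartAt (Euc m) x₀).symm) y =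
      (ambDeriv f ((chartAt (Euc m) x₀).symm y)).comp (chartFrame x₀ y) := by
  rw [← mfderiv_eq_fderiv]
  exact mfderiv_comp y hf ((mdifferentiable_chart (I := 𝓡 m) x₀).mdifferentiableAt_symm hy)

/-- The squared Hilbert-Schmidt norm `|df|²` of the differential of a map into a Euclidean space. -/
def energyDensity (g : RiemMetric m M) (f : M → Euc k) (x : M) : ℝ :=
  ((gram (metricForm g x))⁻¹ * gram (pullForm (ambDeriv f x))).trace

lemma energyDensity_nonneg (g : RiemMetric m M) (f : M → Euc k) (x : M) :
    0 ≤ energyDensity g f x :=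
  trace_gram_inv_mul_pullForm_nonneg (posDef_gram_metricForm g x) _

lemma energyDensity_pos (g : RiemMetric m M) {f : M → Euc k} {x : M}
    (h : ambDeriv (m := m) f x ≠ 0) :
    0 < energyDensity g f x :=
  trace_gram_inv_mul_pullForm_pos (posDef_gram_metricForm g x) h

/-- The energy density may be computed in any chart, although its definition uses at each point the
preferred chart there, which does not vary continuously. -/
lemma energyDensity_chart (g : RiemMetric m M) {f : M → Euc k} (x₀ : M) {y : Euc m}
    (hy : y ∈ (chartAt (Euc m) x₀).target)
    (hf : MDifferentiableAt (𝓡 m) 𝓘(ℝ, Euc k) f ((chartAt (Euc m) x₀).symm y)) :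
    energyDensity g f ((chartAt (Euc m) x₀).symm y) =
      ((chartGram g x₀ y)⁻¹ *
        gram (pullForm (fderiv ℝ (f ∘ (chartAt (Euc m) x₀).symm) y))).trace := by
  rw [ambDeriv_comp_chart x₀ hy hf, chartGram_eq_gram]
  exact (trace_gram_inv_mul_bilinearComp _ _ (chartFrame_injective x₀ hy)).symm

lemma continuous_energyDensity (g : RiemMetric m M) {f : M → Euc k}
    (hf : ContMDiff (𝓡 m) 𝓘(ℝ, Euc k) ∞ f) : Continuous (energyDensity g f) := by
  refine continuous_iff_continuousAt.2 fun x₀ => ?_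
  have ho := (chartAt (Euc m) x₀).open_target
  have h1 : ContDiffOn ℝ ∞ (f ∘ (chartAt (Euc m) x₀).symm) (chartAt (Euc m) x₀).target :=
    (hf.comp_contMDiffOn (contMDiffOn_chart_symm (I := 𝓡 m) (n := ∞) (x := x₀))).contDiffOn
  have h2 := h1.continuousOn_fderiv_of_isOpen ho (by simp)
  have h3 : ContinuousOn (fun y => gram (pullForm (fderiv ℝ (f ∘ (chartAt (Euc m) x₀).symm) y)))
      (chartAt (Euc m) x₀).target :=
    continuousOn_pi.2 fun i => continuousOn_pi.2 fun j =>
      (h2.clm_apply continuousOn_const).inner (𝕜 := ℝ) (h2.clm_apply continuousOn_const)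
  have h4 : ContinuousOn (fun y => (chartGram g x₀ y)⁻¹) (chartAt (Euc m) x₀).target := by
    intro y hy
    have hd := (posDef_chartGram g x₀ hy).det_pos.ne'
    refine ContinuousAt.comp_continuousWithinAt (continuousAt_matrix_inv _ ?_)
      (continuousOn_chartGram g x₀ y hy)
    rw [Ring.inverse_eq_inv']
    exact continuousAt_inv₀ hd
  have h5 : ContinuousOn (fun y => energyDensity g f ((chartAt (Euc m) x₀).symm y))
      (chartAt (Euc m) x₀).target := by
    refine ContinuousOn.congr (f := fun y => ((chartGram g x₀ y)⁻¹ *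
        gram (pullForm (fderiv ℝ (f ∘ (chartAt (Euc m) x₀).symm) y))).trace) ?_
      fun y hy => energyDensity_chart g x₀ hy (hf.mdifferentiable (by simp) _)
    intro y hy
    exact (continuous_id.matrix_trace.continuousAt).comp_continuousWithinAt
      ((h4 y hy).mul (h3 y hy))
  have hs := mem_chart_source (Euc m) x₀
  have h6 := (h5.continuousAt (ho.mem_nhds ((chartAt (Euc m) x₀).map_source hs))).comp
    ((chartAt (Euc m) x₀).continuousAt hs)
  refine h6.congr ?_
  filter_upwards [(chartAt (Euc m) x₀).open_source.mem_nhds hs] with x hx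
  simp [(chartAt (Euc m) x₀).left_inv hx]

lemma normSqDiff_eq_energyDensity (g : RiemMetric m M) {ψ : M → Sphere n} {x : M}
    (hψ : MDifferentiableAt (𝓡 m) (𝓡 n) ψ x) :
    normSqDiff g (roundMetric n) ψ x = energyDensity g (fun x => (ψ x : Euc (n + 1))) x := by
  unfold normSqDiff energyDensity
  congr 2
  ext i j
  simp only [gram, Matrix.of_apply, pullForm_apply, ambDeriv_coe_sphere hψ]
  rfl

/-- Conformality of the boosts: composing with one multiplies `|dψ|²` by the square of the conformal
factor. -/
lemma energyDensity_boost (g : RiemMetric m M) {ψ : M → Sphere n} {x : M}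
    (hψ : MDifferentiableAt (𝓡 m) (𝓡 n) ψ x) {V : Euc (n + 1)} (hV : ‖V‖ = 1) (r : ℝ) :
    energyDensity g (fun x => (boost V hV r (ψ x) : Euc (n + 1))) x =
      (boostDen V r (ψ x : Euc (n + 1)) ^ 2)⁻¹ *
        energyDensity g (fun x => (ψ x : Euc (n + 1))) x := by
  have hp := norm_eq_of_mem_sphere (ψ x)
  have hf : MDifferentiableAt (𝓡 m) 𝓘(ℝ, Euc (n + 1)) (fun x => (ψ x : Euc (n + 1))) x :=
    ((contMDiff_sphere_incl (n := n)).mdifferentiable (by simp) (ψ x)).comp x hψ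
  have h1 : ambDeriv (m := m) (fun x => (boost V hV r (ψ x) : Euc (n + 1))) x =
      (fderiv ℝ (boostAux V r) (ψ x : Euc (n + 1))).comp
        (ambDeriv (fun x => (ψ x : Euc (n + 1))) x) := by
    rw [← mfderiv_eq_fderiv]
    exact mfderiv_comp (g := boostAux V r) x
      (differentiableAt_boostAux hV hp r).mdifferentiableAt hf
  have h2 : gram (pullForm (ambDeriv (m := m) (fun x => (boost V hV r (ψ x) : Euc (n + 1))) x)) =
      (boostDen V r (ψ x : Euc (n + 1)) ^ 2)⁻¹ •
        gram (pullForm (ambDeriv (fun x => (ψ x : Euc (n + 1))) x)) := by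
    ext i j
    rw [h1]
    exact inner_fderiv_boostAux hV hp r (inner_ambDeriv_coe_sphere hψ _)
      (inner_ambDeriv_coe_sphere hψ _)
  rw [energyDensity, h2, Matrix.mul_smul, Matrix.trace_smul]
  rfl

end NormSqDiff

/-! ### The Riemannian volume -/

section Volume

variable {m : ℕ} {M : Type*} [TopologicalSpace M] [ChartedSpace (Euc m) M]
  [IsManifold (𝓡 m) ∞ M]

lemma continuousOn_sqrt_det_chartGram (g : RiemMetric m M) (x₀ : M) :
    ContinuousOn (fun y => ENNReal.ofReal (Real.sqrt (chartGram g x₀ y).det))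
      (chartAt (Euc m) x₀).target := by
  have h : Continuous fun A : Matrix (Fin m) (Fin m) ℝ => ENNReal.ofReal (Real.sqrt A.det) :=
    ENNReal.continuous_ofReal.comp (Real.continuous_sqrt.comp continuous_id.matrix_det)
  exact h.comp_continuousOn (continuousOn_chartGram g x₀)

lemma isSubordinate_chartPartition [T2Space M] [SigmaCompactSpace M] :
    (chartPartition m M).IsSubordinate (fun x => (chartAt (Euc m) x).source) :=
  (SmoothPartitionOfUnity.exists_isSubordinate_chartAt_source (𝓡 m) M).choose_spec

variable [MeasurableSpace M] [BorelSpace M]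

lemma chartVolume_apply (g : RiemMetric m M) (x₀ : M) {s : Set M} (hs : MeasurableSet s) :
    chartVolume g x₀ s = ∫⁻ y in (chartAt (Euc m) x₀).target ∩ (chartAt (Euc m) x₀).symm ⁻¹' s,
      ENNReal.ofReal (Real.sqrt (chartGram g x₀ y).det) := by
  have hT := (chartAt (Euc m) x₀).open_target.measurableSet
  have hae := ((chartAt (Euc m) x₀).continuousOn_symm.aemeasurable (μ := volume) hT)
  have hms : MeasurableSet ((chartAt (Euc m) x₀).target ∩ (chartAt (Euc m) x₀).symm ⁻¹' s) := by
    have := hT.subtype_image ((chartAt (Euc m) x₀).continuousOn_symm.domRestrict.measurable hs)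
    convert this using 1
    ext y
    simp [and_comm]
  rw [chartVolume, Measure.map_apply_of_aemeasurable
    (hae.mono_ac (withDensity_absolutelyContinuous _ _)) hs]
  have h1 : (volume.restrict (chartAt (Euc m) x₀).target).withDensity
      (fun y => ENNReal.ofReal (Real.sqrt (chartGram g x₀ y).det)) =
      (volume.withDensity (fun y => ENNReal.ofReal (Real.sqrt (chartGram g x₀ y).det))).restrict
        (chartAt (Euc m) x₀).target := (restrict_withDensity hT _).symm
  rw [h1, Measure.restrict_apply' hT, inter_comm, withDensity_apply _ hms]

lemma chartVolume_lt_top_of_isCompact [T2Space M] (g : RiemMetric m M) (x₀ : M) {K : Set M}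
    (hK : IsCompact K) (hKs : K ⊆ (chartAt (Euc m) x₀).source) : chartVolume g x₀ K < ⊤ := by
  set φ := chartAt (Euc m) x₀
  have hφK : IsCompact (φ '' K) := hK.image_of_continuousOn (φ.continuousOn.mono hKs)
  have hsub : φ '' K ⊆ φ.target := by
    rintro _ ⟨x, hx, rfl⟩; exact φ.map_source (hKs hx)
  have heq : φ.target ∩ φ.symm ⁻¹' K = φ '' K := by
    ext y
    constructor
    · rintro ⟨h1, h2⟩
      exact ⟨φ.symm y, h2, φ.right_inv h1⟩
    · rintro ⟨x, hx, rfl⟩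
      exact ⟨φ.map_source (hKs hx), by simpa [φ.left_inv (hKs hx)] using hx⟩
  rw [chartVolume_apply g x₀ hK.measurableSet, heq]
  obtain ⟨C, hC⟩ := hφK.exists_bound_of_continuousOn (f := fun y => Real.sqrt (chartGram g x₀ y).det)
    ((Real.continuous_sqrt.comp continuous_id.matrix_det).comp_continuousOn
      ((continuousOn_chartGram g x₀).mono hsub))
  refine (setLIntegral_mono (g := fun _ => ENNReal.ofReal C) measurable_const fun y hy =>
    ENNReal.ofReal_le_ofReal ((le_abs_self _).trans (hC y hy))).trans_lt ?_
  rw [setLIntegral_const]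
  exact ENNReal.mul_lt_top ENNReal.ofReal_lt_top hφK.measure_lt_top

lemma chartVolume_pos_of_isOpen (g : RiemMetric m M) (x₀ : M) {U : Set M}
    (hU : IsOpen U) (hne : (U ∩ (chartAt (Euc m) x₀).source).Nonempty) :
    0 < chartVolume g x₀ U := by
  set φ := chartAt (Euc m) x₀
  have ho : IsOpen (φ.target ∩ φ.symm ⁻¹' U) := φ.symm.isOpen_inter_preimage hU
  obtain ⟨x, hxU, hxs⟩ := hne
  have hne' : (φ.target ∩ φ.symm ⁻¹' U).Nonempty :=
    ⟨φ x, φ.map_source hxs, by simpa [φ.left_inv hxs] using hxU⟩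
  rw [chartVolume_apply g x₀ hU.measurableSet, pos_iff_ne_zero, ne_eq, lintegral_eq_zero_iff'
    (((continuousOn_sqrt_det_chartGram g x₀).mono inter_subset_left).aemeasurable
      ho.measurableSet)]
  intro h
  have h1 := (ae_restrict_iff' ho.measurableSet).1 h
  have h2 : volume (φ.target ∩ φ.symm ⁻¹' U) = 0 := by
    refine measure_eq_zero_iff_ae_notMem.2 (h1.mono fun y hy' hy => ?_)
    have h3 := hy' hy
    simp only [Pi.zero_apply, ENNReal.ofReal_eq_zero] at h3
    exact (Real.sqrt_pos.2 (posDef_chartGram g x₀ hy.1).det_pos).not_ge h3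
  exact (ho.measure_pos volume hne').ne' h2

variable [T2Space M]

/-- On a compact manifold the partition of unity has finitely many nonzero members, and each
contributes a finite measure because its support is a compact subset of a chart domain. -/
lemma isFiniteMeasure_riemVolume [CompactSpace M] (g : RiemMetric m M) :
    IsFiniteMeasure (riemVolume g) := by
  have hfin := (chartPartition m M).locallyFinite.finite_nonempty_of_compact
  have hzero : ∀ x₀ : M, x₀ ∉ {i | (Function.support (chartPartition m M i)).Nonempty} →
      (chartVolume g x₀).withDensity (fun x => ENNReal.ofReal (chartPartition m M x₀ x)) univ
        = 0 := by
    intro x₀ hx₀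
    have h0 : ∀ x, chartPartition m M x₀ x = 0 := by
      intro x
      by_contra hx
      exact hx₀ ⟨x, hx⟩
    simp [h0]
  refine ⟨?_⟩
  rw [riemVolume, Measure.sum_apply _ MeasurableSet.univ,
    tsum_eq_sum (s := hfin.toFinset) fun x₀ hx₀ => hzero x₀ (by simpa using hx₀)]
  refine ENNReal.sum_lt_top.2 fun x₀ _ => ?_
  have hK : IsCompact (tsupport (chartPartition m M x₀)) := (isClosed_tsupport _).isCompact
  rw [withDensity_apply _ MeasurableSet.univ, setLIntegral_univ]
  calc ∫⁻ x, ENNReal.ofReal (chartPartition m M x₀ x) ∂(chartVolume g x₀)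
      ≤ ∫⁻ x, (tsupport (chartPartition m M x₀)).indicator 1 x ∂(chartVolume g x₀) := by
        refine lintegral_mono fun x => ?_
        by_cases hx : x ∈ tsupport (chartPartition m M x₀)
        · simpa [hx] using (chartPartition m M).le_one x₀ x
        · simp [hx, image_eq_zero_of_notMem_tsupport hx]
    _ = chartVolume g x₀ (tsupport (chartPartition m M x₀)) :=
        lintegral_indicator_one hK.measurableSet
    _ < ⊤ := chartVolume_lt_top_of_isCompact g x₀ hK (isSubordinate_chartPartition x₀)

lemma riemVolume_pos_of_isOpen [SigmaCompactSpace M] (g : RiemMetric m M) {U : Set M}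
    (hU : IsOpen U) (hne : U.Nonempty) : 0 < riemVolume g U := by
  obtain ⟨x, hx⟩ := hne
  obtain ⟨x₀, hx₀⟩ := (chartPartition m M).exists_pos_of_mem (mem_univ x)
  set ρ := chartPartition m M x₀
  have hρ : Continuous ρ := ρ.contMDiff.continuous
  have hW : IsOpen (U ∩ {z | 0 < ρ z}) := hU.inter (isOpen_lt continuous_const hρ)
  have hx' : x ∈ (chartAt (Euc m) x₀).source :=
    isSubordinate_chartPartition x₀ (subset_tsupport _ hx₀.ne')
  have h1 := chartVolume_pos_of_isOpen g x₀ hW ⟨x, ⟨hx, hx₀⟩, hx'⟩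
  rw [riemVolume, Measure.sum_apply _ hU.measurableSet]
  refine lt_of_lt_of_le ?_ (ENNReal.le_tsum x₀)
  have hm : Measurable fun z => ENNReal.ofReal (ρ z) := hρ.measurable.ennreal_ofReal
  rw [pos_iff_ne_zero, ne_eq, withDensity_apply_eq_zero hm]
  intro h
  refine h1.ne' (measure_mono_null ?_ h)
  intro z hz
  exact ⟨by simpa using hz.2, hz.1⟩

end Volume

/-! ### The variation by boosts -/

section Variation

variable {m n : ℕ}
  {M : Type*} [TopologicalSpace M] [ChartedSpace (Euc m) M]

lemma contMDiff_boost_comp {ψ : M → Sphere n} (hψ : ContMDiff (𝓡 m) (𝓡 n) ∞ ψ)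
    {V : Euc (n + 1)} (hV : ‖V‖ = 1) :
    ContMDiff (𝓘(ℝ, ℝ).prod (𝓡 m)) (𝓡 n) ∞ (fun q : ℝ × M => boost V hV q.1 (ψ q.2)) := by
  have h : ContMDiff (𝓘(ℝ, ℝ).prod (𝓡 m)) (𝓘(ℝ, ℝ).prod (𝓡 n)) ∞
      (fun q : ℝ × M => (q.1, ψ q.2)) := contMDiff_fst.prodMk (hψ.comp contMDiff_snd)
  have h' := ContMDiff.comp (g := fun q : ℝ × Sphere n => boost V hV q.1 q.2)
    (f := fun q : ℝ × M => (q.1, ψ q.2)) (contMDiff_boost V hV) h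
  exact h'

lemma contMDiff_boost_add_comp {ψ : M → Sphere n} (hψ : ContMDiff (𝓡 m) (𝓡 n) ∞ ψ)
    {V : Euc (n + 1)} (hV : ‖V‖ = 1) :
    ContMDiff (𝓘(ℝ, ℝ).prod (𝓘(ℝ, ℝ).prod (𝓡 m))) (𝓡 n) ∞
      (fun q : ℝ × ℝ × M => boost V hV (q.1 + q.2.1) (ψ q.2.2)) := by
  have h : ContMDiff (𝓘(ℝ, ℝ).prod (𝓘(ℝ, ℝ).prod (𝓡 m))) (𝓘(ℝ, ℝ).prod (𝓡 m)) ∞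
      (fun q : ℝ × ℝ × M => (q.1 + q.2.1, q.2.2)) :=
    (contMDiff_fst.add (contMDiff_fst.comp contMDiff_snd)).prodMk
      (contMDiff_snd.comp contMDiff_snd)
  have h' := ContMDiff.comp (g := fun q : ℝ × M => boost V hV q.1 (ψ q.2))
    (f := fun q : ℝ × ℝ × M => (q.1 + q.2.1, q.2.2)) (contMDiff_boost_comp hψ hV) h
  exact h'

/-- The velocity field along `ψ` of the family of boosts of `ψ`. -/
def boostField (ψ : M → Sphere n) (V : Euc (n + 1)) (hV : ‖V‖ = 1) (x : M) :
    TangentSpace (𝓡 n) (ψ x) :=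
  (mfderiv 𝓘(ℝ, ℝ) (𝓡 n) (fun t : ℝ => boost V hV t (ψ x)) 0 (1 : ℝ) : Euc n)

lemma tangentBundle_mk_mfderiv_congr {c c' : ℝ → Sphere n} {p p' : Sphere n} (hc : c = c')
    (hp : p = p') :
    (⟨p, (mfderiv 𝓘(ℝ, ℝ) (𝓡 n) c 0 (1 : ℝ) : Euc n)⟩ : TangentBundle (𝓡 n) (Sphere n)) =
      ⟨p', (mfderiv 𝓘(ℝ, ℝ) (𝓡 n) c' 0 (1 : ℝ) : Euc n)⟩ := by
  subst hc hp
  rfl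

lemma isVariation₂_boost {ψ : M → Sphere n} (hψ : ContMDiff (𝓡 m) (𝓡 n) ∞ ψ)
    {V : Euc (n + 1)} (hV : ‖V‖ = 1) :
    IsVariation₂ m n ψ (boostField ψ V hV) (boostField ψ V hV) 1
      (fun t s x => boost V hV (t + s) (ψ x)) where
  pos := one_pos
  smooth := (contMDiff_boost_add_comp hψ hV).contMDiffOn
  zero := by ext1 x; simp [boost_zero]
  deriv_t x := tangentBundle_mk_mfderiv_congr (by simp) (by simp [boost_zero])
  deriv_s x := tangentBundle_mk_mfderiv_congr (by simp) (by simp [boost_zero])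

variable [IsManifold (𝓡 m) ∞ M]

lemma isVectorFieldAlong_boostField [CompactSpace M] {ψ : M → Sphere n}
    (hψ : ContMDiff (𝓡 m) (𝓡 n) ∞ ψ) {V : Euc (n + 1)} (hV : ‖V‖ = 1) :
    IsVectorFieldAlong m n ψ (boostField ψ V hV) := by
  refine ⟨?_, isClosed_closure.isCompact⟩
  have hF := contMDiff_boost_comp hψ hV
  -- The field is the image of the section `(∂ₜ, 0)` of `T(ℝ × M)` over `{0} × M` under the tangent
  -- map of `(t, x) ↦ boost t (ψ x)`.
  let F₁ : M → TangentBundle 𝓘(ℝ, ℝ) ℝ × TangentBundle (𝓡 m) M :=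
    fun x => (⟨0, (1 : ℝ)⟩, ⟨x, (0 : Euc m)⟩)
  have S₁ : ContMDiff (𝓡 m) (𝓘(ℝ, ℝ).tangent.prod (𝓡 m).tangent) ∞ F₁ :=
    contMDiff_const.prodMk (Bundle.contMDiff_zeroSection ℝ (TangentSpace (𝓡 m) : M → Type _))
  have S₂ := contMDiff_equivTangentBundleProd_symm (I := 𝓘(ℝ, ℝ)) (M := ℝ) (I' := 𝓡 m)
    (M' := M) (n := ∞)
  have S₃ := hF.contMDiff_tangentMap (m := ∞) (by simp)
  have S := (S₃.comp S₂).comp S₁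
  refine S.congr fun x => ?_
  have h : (mfderiv (𝓘(ℝ, ℝ).prod (𝓡 m)) (𝓡 n) (fun q : ℝ × M => boost V hV q.1 (ψ q.2))
      (0, x) ((1 : ℝ), (0 : Euc m)) : Euc n) =
      mfderiv 𝓘(ℝ, ℝ) (𝓡 n) (fun t : ℝ => boost V hV t (ψ x)) 0 (1 : ℝ) :=
    (mfderiv_prod_eq_add_apply (p := ((0 : ℝ), x)) (v := ((1 : ℝ), (0 : Euc m)))
      (hF.mdifferentiable (by simp) (0, x))).trans
      ((congrArg _ (map_zero (mfderiv (𝓡 m) (𝓡 n) (fun z => boost V hV 0 (ψ z)) x))).trans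
        (add_zero _))
  change (⟨ψ x, boostField ψ V hV x⟩ : TangentBundle (𝓡 n) (Sphere n)) =
    ⟨boost V hV 0 (ψ x), (mfderiv (𝓘(ℝ, ℝ).prod (𝓡 m)) (𝓡 n)
      (fun q : ℝ × M => boost V hV q.1 (ψ q.2)) (0, x) ((1 : ℝ), (0 : Euc m)) : Euc n)⟩
  rw [h]
  exact tangentBundle_mk_mfderiv_congr rfl (boost_zero V hV (ψ x)).symm

end Variation

/-! ### The second variation in the direction of a boost -/

/-- Differentiation under the integral sign over a compact space, where joint continuity of the
derivative provides the bound. -/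
lemma hasDerivAt_integral_of_continuous {X : Type*} [TopologicalSpace X] [CompactSpace X]
    [MeasurableSpace X] [BorelSpace X] (μ : Measure X) [IsFiniteMeasure μ] {f f' : ℝ → X → ℝ}
    (hf : Continuous fun q : ℝ × X => f q.1 q.2) (hf' : Continuous fun q : ℝ × X => f' q.1 q.2)
    (hd : ∀ r x, HasDerivAt (fun t => f t x) (f' r x) r) (r : ℝ) :
    HasDerivAt (fun t => ∫ x, f t x ∂μ) (∫ x, f' r x ∂μ) r := by
  obtain ⟨C, hC⟩ := ((isCompact_Icc (a := r - 1) (b := r + 1)).prod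
    (isCompact_univ (X := X))).exists_bound_of_continuousOn hf'.continuousOn
  have hc : ∀ t, Continuous (f t) := fun t => hf.comp (Continuous.prodMk_right t)
  have hc' : ∀ t, Continuous (f' t) := fun t => hf'.comp (Continuous.prodMk_right t)
  have hm : ∀ {h : X → ℝ}, Continuous h → AEStronglyMeasurable h μ := fun h =>
    h.measurable.aestronglyMeasurable
  obtain ⟨D, hD⟩ := (isCompact_univ (X := X)).exists_bound_of_continuousOn (hc r).continuousOn
  refine (hasDerivAt_integral_of_dominated_loc_of_deriv_le (bound := fun _ => C)
    (Icc_mem_nhds (by linarith) (by linarith) : Icc (r - 1) (r + 1) ∈ 𝓝 r)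
    (Eventually.of_forall fun t => hm (hc t)) ?_ (hm (hc' r)) ?_ (integrable_const C) ?_).2
  · exact Integrable.of_bound (hm (hc r)) D (Eventually.of_forall fun x => hD x (mem_univ x))
  · exact Eventually.of_forall fun x t ht => hC (t, x) ⟨ht, mem_univ x⟩
  · exact Eventually.of_forall fun x t _ => hd t x

section Integrand

/-- The integrand `(1 + λ² e)^α` of the `α`-energy of a boosted map, where `λ⁻¹ = cosh r + u sinh r`,
`e` is the energy density of the map, and `u` is its component in the direction of the boost. -/
def boostIntegrand (α u e r : ℝ) : ℝ :=
  (1 + ((Real.cosh r + Real.sinh r * u) ^ 2)⁻¹ * e) ^ α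

/-- The derivative of `boostIntegrand` in `r`. -/
def boostIntegrandDeriv (α u e r : ℝ) : ℝ :=
  -2 * α * e * ((1 + ((Real.cosh r + Real.sinh r * u) ^ 2)⁻¹ * e) ^ (α - 1) *
    ((Real.sinh r + Real.cosh r * u) * ((Real.cosh r + Real.sinh r * u) ^ 3)⁻¹))

/-- The second derivative of `boostIntegrand` in `r`. -/
def boostIntegrandDeriv₂ (α u e r : ℝ) : ℝ :=
  -2 * α * e * (
    (-2 * (α - 1) * e * ((1 + ((Real.cosh r + Real.sinh r * u) ^ 2)⁻¹ * e) ^ (α - 2) *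
    ((Real.sinh r + Real.cosh r * u) * ((Real.cosh r + Real.sinh r * u) ^ 3)⁻¹))) *
    ((Real.sinh r + Real.cosh r * u) * ((Real.cosh r + Real.sinh r * u) ^ 3)⁻¹) +
    (1 + ((Real.cosh r + Real.sinh r * u) ^ 2)⁻¹ * e) ^ (α - 1) *
    ((Real.cosh r + Real.sinh r * u) * ((Real.cosh r + Real.sinh r * u) ^ 3)⁻¹ -
      (Real.sinh r + Real.cosh r * u) * (3 * (Real.sinh r + Real.cosh r * u) *
        ((Real.cosh r + Real.sinh r * u) ^ 4)⁻¹)))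

variable {u e : ℝ}

lemma hasDerivAt_boostDen (u r : ℝ) :
    HasDerivAt (fun t => Real.cosh t + Real.sinh t * u) (Real.sinh r + Real.cosh r * u) r :=
  (Real.hasDerivAt_cosh r).add ((Real.hasDerivAt_sinh r).mul_const u)

lemma one_add_boost_pos (he : 0 ≤ e) (r : ℝ) :
    0 < 1 + ((Real.cosh r + Real.sinh r * u) ^ 2)⁻¹ * e := by positivity

lemma hasDerivAt_boostIntegrand (α : ℝ) (hu : |u| ≤ 1) (he : 0 ≤ e) (r : ℝ) :
    HasDerivAt (boostIntegrand α u e) (boostIntegrandDeriv α u e r) r := by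
  have hD := (cosh_add_sinh_mul_pos hu r).ne'
  have h := ((((((hasDerivAt_boostDen u r).pow 2).inv (pow_ne_zero 2 hD)).mul_const e).const_add
    1).rpow_const (p := α) (Or.inl (one_add_boost_pos he r).ne'))
  refine h.congr_deriv ?_
  simp only [Pi.pow_apply, Pi.inv_apply, boostIntegrandDeriv]
  field_simp
  ring

lemma hasDerivAt_boostIntegrandDeriv (α : ℝ) (hu : |u| ≤ 1) (he : 0 ≤ e) (r : ℝ) :
    HasDerivAt (boostIntegrandDeriv α u e) (boostIntegrandDeriv₂ α u e r) r := by
  have hD := (cosh_add_sinh_mul_pos hu r).ne'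
  have h0 := hasDerivAt_boostIntegrand (α - 1) hu he r
  have hN : HasDerivAt (fun t => Real.sinh t + Real.cosh t * u)
      (Real.cosh r + Real.sinh r * u) r :=
    (Real.hasDerivAt_sinh r).add ((Real.hasDerivAt_cosh r).mul_const u)
  have h := (h0.mul (hN.mul (((hasDerivAt_boostDen u r).pow 3).inv
    (pow_ne_zero 3 hD)))).const_mul (-2 * α * e)
  refine h.congr_deriv ?_
  have h2 : α - 1 - 1 = α - 2 := by ring
  simp only [Pi.pow_apply, Pi.inv_apply, Pi.mul_apply, boostIntegrandDeriv, boostIntegrandDeriv₂,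
    boostIntegrand, h2]
  field_simp
  ring

lemma boostIntegrandDeriv₂_zero (α u : ℝ) (he : 0 ≤ e) :
    boostIntegrandDeriv₂ α u e 0 = 2 * α * (1 + e) ^ (α - 2) * e *
      (2 * (α - 1) * e * u ^ 2 + (1 + e) * (3 * u ^ 2 - 1)) := by
  have h : (1 + e) ^ (α - 1) = (1 + e) ^ (α - 2) * (1 + e) := by
    rw [← Real.rpow_add_one (by positivity)]; congr 1; ring
  simp only [boostIntegrandDeriv₂, Real.cosh_zero, Real.sinh_zero]
  simp only [zero_mul, add_zero, one_pow, inv_one, one_mul, zero_add, mul_one, h]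
  ring

variable {X : Type*} [TopologicalSpace X] {U E : X → ℝ}

lemma continuous_one_add_boost (hU : Continuous U) (hE : Continuous E) (hu : ∀ x, |U x| ≤ 1) :
    Continuous fun q : ℝ × X =>
      1 + ((Real.cosh q.1 + Real.sinh q.1 * U q.2) ^ 2)⁻¹ * E q.2 := by
  have hD : ∀ q : ℝ × X, (Real.cosh q.1 + Real.sinh q.1 * U q.2) ^ 2 ≠ 0 := fun q =>
    pow_ne_zero 2 (cosh_add_sinh_mul_pos (hu q.2) q.1).ne'
  have := Real.continuous_cosh
  have := Real.continuous_sinh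
  fun_prop (disch := assumption)

lemma continuous_boostIntegrand (α : ℝ) (hU : Continuous U) (hE : Continuous E)
    (hu : ∀ x, |U x| ≤ 1) (he : ∀ x, 0 ≤ E x) :
    Continuous fun q : ℝ × X => boostIntegrand α (U q.2) (E q.2) q.1 :=
  (continuous_one_add_boost hU hE hu).rpow_const fun q => Or.inl (one_add_boost_pos (he q.2) q.1).ne'

lemma continuous_boostIntegrandDeriv (α : ℝ) (hU : Continuous U) (hE : Continuous E)
    (hu : ∀ x, |U x| ≤ 1) (he : ∀ x, 0 ≤ E x) :
    Continuous fun q : ℝ × X => boostIntegrandDeriv α (U q.2) (E q.2) q.1 := by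
  have hD : ∀ q : ℝ × X, (Real.cosh q.1 + Real.sinh q.1 * U q.2) ^ 3 ≠ 0 := fun q =>
    pow_ne_zero 3 (cosh_add_sinh_mul_pos (hu q.2) q.1).ne'
  have h1 := continuous_boostIntegrand (α - 1) hU hE hu he
  have := Real.continuous_cosh
  have := Real.continuous_sinh
  unfold boostIntegrand at h1
  unfold boostIntegrandDeriv
  fun_prop (disch := assumption)

lemma continuous_boostIntegrandDeriv₂ (α : ℝ) (hU : Continuous U) (hE : Continuous E)
    (hu : ∀ x, |U x| ≤ 1) (he : ∀ x, 0 ≤ E x) :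
    Continuous fun q : ℝ × X => boostIntegrandDeriv₂ α (U q.2) (E q.2) q.1 := by
  have hD : ∀ q : ℝ × X, (Real.cosh q.1 + Real.sinh q.1 * U q.2) ^ 3 ≠ 0 := fun q =>
    pow_ne_zero 3 (cosh_add_sinh_mul_pos (hu q.2) q.1).ne'
  have hD' : ∀ q : ℝ × X, (Real.cosh q.1 + Real.sinh q.1 * U q.2) ^ 4 ≠ 0 := fun q =>
    pow_ne_zero 4 (cosh_add_sinh_mul_pos (hu q.2) q.1).ne'
  have h1 := continuous_boostIntegrand (α - 1) hU hE hu he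
  have h2 := continuous_boostIntegrand (α - 2) hU hE hu he
  have := Real.continuous_cosh
  have := Real.continuous_sinh
  unfold boostIntegrand at h1 h2
  unfold boostIntegrandDeriv₂
  fun_prop (disch := assumption)

end Integrand

/-- If `2α ≤ n`, then `n > 2` and the quotient is not positive, so that the bound on `e ≥ 0` fails
(for `2α = n` the quotient is the junk value `0`). -/
lemma mul_lt_of_lt_div_of_nonneg {n : ℕ} {α e : ℝ} (hα : 1 < α) (he : 0 ≤ e)
    (h : e < ((n : ℝ) - 2) / (2 * α - n)) : (2 * α - n) * e < n - 2 := by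
  rcases lt_or_ge 0 (2 * α - n : ℝ) with hp | hp
  · rw [mul_comm]
    exact (lt_div_iff₀ hp).1 h
  · exact absurd (he.trans_lt h) (div_nonpos_of_nonneg_of_nonpos (by linarith) hp).not_gt

lemma norm_stdVec {m : ℕ} (i : Fin m) : ‖(stdVec i : Euc m)‖ = 1 := by
  simp [stdVec]

section Energy

variable {m n : ℕ}
    {M : Type*} [TopologicalSpace M] [T2Space M] [CompactSpace M]
    [ChartedSpace (Euc m) M] [IsManifold (𝓡 m) ∞ M]
    [MeasurableSpace M]

lemma alphaEnergy_boost (g : RiemMetric m M) (α : ℝ) {ψ : M → Sphere n}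
    (hψ : ContMDiff (𝓡 m) (𝓡 n) ∞ ψ) {V : Euc (n + 1)} (hV : ‖V‖ = 1) (r : ℝ) :
    alphaEnergy g (roundMetric n) α (fun x => boost V hV r (ψ x)) =
      ∫ x, boostIntegrand α (inner ℝ V (ψ x : Euc (n + 1)))
        (energyDensity g (fun x => (ψ x : Euc (n + 1))) x) r ∂(riemVolume g) := by
  refine integral_congr_ae (Eventually.of_forall fun x => ?_)
  have hd : MDifferentiableAt (𝓡 m) (𝓡 n) (fun x => boost V hV r (ψ x)) x :=
    ((contMDiff_boost_comp hψ hV).comp (contMDiff_const.prodMk contMDiff_id)).mdifferentiable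
      (by simp) x
  simp only [normSqDiff_eq_energyDensity g hd,
    energyDensity_boost g (hψ.mdifferentiable (by simp) x) hV]
  rfl

variable [BorelSpace M]

lemma secondVariation_boost (g : RiemMetric m M) (α : ℝ) {ψ : M → Sphere n}
    (hψ : ContMDiff (𝓡 m) (𝓡 n) ∞ ψ) {V : Euc (n + 1)} (hV : ‖V‖ = 1) :
    secondVariation g (roundMetric n) α (fun t s x => boost V hV (t + s) (ψ x)) =
      ∫ x, boostIntegrandDeriv₂ α (inner ℝ V (ψ x : Euc (n + 1)))
        (energyDensity g (fun x => (ψ x : Euc (n + 1))) x) 0 ∂(riemVolume g) := by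
  have := isFiniteMeasure_riemVolume g
  have hf : ContMDiff (𝓡 m) 𝓘(ℝ, Euc (n + 1)) ∞ (fun x => (ψ x : Euc (n + 1))) :=
    contMDiff_sphere_incl.comp hψ
  have hE := continuous_energyDensity g hf
  have hU : Continuous fun x => (inner ℝ V (ψ x : Euc (n + 1)) : ℝ) :=
    continuous_const.inner hf.continuous
  have hu : ∀ x, |(inner ℝ V (ψ x : Euc (n + 1)) : ℝ)| ≤ 1 := fun x =>
    abs_inner_le_one hV (norm_eq_of_mem_sphere (ψ x))
  have he := energyDensity_nonneg g (fun x => (ψ x : Euc (n + 1)))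
  have h1 := hasDerivAt_integral_of_continuous (riemVolume g)
    (continuous_boostIntegrand α hU hE hu he) (continuous_boostIntegrandDeriv α hU hE hu he)
    (fun r x => hasDerivAt_boostIntegrand α (hu x) (he x) r)
  have h2 := hasDerivAt_integral_of_continuous (riemVolume g)
    (continuous_boostIntegrandDeriv α hU hE hu he) (continuous_boostIntegrandDeriv₂ α hU hE hu he)
    (fun r x => hasDerivAt_boostIntegrandDeriv α (hu x) (he x) r)
  unfold secondVariation
  simp only [alphaEnergy_boost g α hψ hV]
  refine (congrArg (fun F : ℝ → ℝ => deriv F 0) (funext fun t => ?_)).trans (h2 0).deriv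
  have h3 := h1 (t + 0)
  rw [add_zero] at h3
  exact (HasDerivAt.comp_const_add t 0 (by rwa [add_zero])).deriv

/-- Summed over the directions of an orthonormal basis, the second derivatives depend on `e` alone,
because the squares of the components of a unit vector add up to `1`. -/
lemma sum_boostIntegrandDeriv₂_zero (α : ℝ) {y : Euc (n + 1)} (hy : ‖y‖ = 1) {e : ℝ}
    (he : 0 ≤ e) :
    ∑ i, boostIntegrandDeriv₂ α (inner ℝ (stdVec i) y) e 0 =
      -(2 * α * (1 + e) ^ (α - 2) * e * ((n - 2) - (2 * α - n) * e)) := by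
  have h0 : ∀ i, (inner ℝ (stdVec i) y : ℝ) = y i := fun i => by
    rw [stdVec]; simpa using EuclideanSpace.inner_single_left i (1 : ℝ) y
  have h1 : ∑ i, (inner ℝ (stdVec i) y : ℝ) ^ 2 = 1 := by
    simp only [h0, ← EuclideanSpace.real_norm_sq_eq, hy, one_pow]
  have h2 : ∀ i : Fin (n + 1), boostIntegrandDeriv₂ α (inner ℝ (stdVec i) y) e 0 =
      2 * α * (1 + e) ^ (α - 2) * e * (2 * (α - 1) * e + 3 * (1 + e)) *
        (inner ℝ (stdVec i) y : ℝ) ^ 2 - 2 * α * (1 + e) ^ (α - 2) * e * (1 + e) := fun i => by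
    rw [boostIntegrandDeriv₂_zero α _ he]; ring
  simp only [h2, Finset.sum_sub_distrib, ← Finset.mul_sum, h1, Finset.sum_const,
    Finset.card_univ, Fintype.card_fin, nsmul_eq_mul]
  push_cast
  ring

end Energy

/-- Under the bound on `e`, some direction of an orthonormal basis has negative second variation,
since the sum over the basis is negative. -/
lemma exists_integral_boostIntegrandDeriv₂_neg {X : Type*} [TopologicalSpace X] [CompactSpace X]
    [MeasurableSpace X] [BorelSpace X] (μ : Measure X) [IsFiniteMeasure μ] [μ.IsOpenPosMeasure]
    {n : ℕ} {α : ℝ} (hα : 1 < α) {f : X → Euc (n + 1)} (hf : Continuous f)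
    (hnorm : ∀ x, ‖f x‖ = 1) {e : X → ℝ} (hec : Continuous e) (he : ∀ x, 0 ≤ e x)
    (hlt : ∀ x, (2 * α - n) * e x < n - 2) {x₁ : X} (hx₁ : 0 < e x₁) :
    ∃ i, ∫ x, boostIntegrandDeriv₂ α (inner ℝ (stdVec i) (f x)) (e x) 0 ∂μ < 0 := by
  by_contra! hnonneg
  have hint : ∀ {q : X → ℝ}, Continuous q → Integrable q μ := fun hq =>
    hq.integrable_of_hasCompactSupport (HasCompactSupport.of_compactSpace _)
  have hcont : ∀ i : Fin (n + 1), Continuous fun x => boostIntegrandDeriv₂ α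
      (inner ℝ (stdVec i) (f x)) (e x) 0 := fun i =>
    (continuous_boostIntegrandDeriv₂ α (continuous_const.inner hf) hec
      (fun x => abs_inner_le_one (norm_stdVec i) (hnorm x)) he).comp
      (Continuous.prodMk_right (0 : ℝ))
  have hsum := Finset.sum_nonneg fun i (_ : i ∈ Finset.univ) => hnonneg i
  rw [← integral_finsetSum _ fun i _ => hint (hcont i)] at hsum
  simp only [sum_boostIntegrandDeriv₂_zero α (hnorm _) (he _), integral_neg] at hsum
  have hqc : Continuous fun x =>
      2 * α * (1 + e x) ^ (α - 2) * e x * ((n - 2) - (2 * α - n) * e x) := by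
    have h1 : Continuous fun x => (1 + e x) ^ (α - 2) :=
      Continuous.rpow_const (f := fun x => 1 + e x) (continuous_const.add hec) fun x =>
        Or.inl (add_pos_of_pos_of_nonneg one_pos (he x)).ne'
    fun_prop
  have hpos : ∀ x, 0 < 2 * α * (1 + e x) ^ (α - 2) := fun x => by
    have : 0 < (1 + e x) ^ (α - 2) := Real.rpow_pos_of_pos (by linarith [he x]) _
    positivity
  have := hqc.integral_pos_of_hasCompactSupport_nonneg_nonzero (μ := μ) (x := x₁)
    (HasCompactSupport.of_compactSpace _)
    (fun x => mul_nonneg (mul_nonneg (hpos x).le (he x)) (sub_nonneg.2 (hlt x).le))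
    (mul_pos (mul_pos (hpos x₁) hx₁) (sub_pos.2 (hlt x₁))).ne'
  linarith

end AlphaHarmonic

end

theorem theorem900 {m n : ℕ}
    {M : Type*} [TopologicalSpace M] [T2Space M] [CompactSpace M]
    [ChartedSpace (EuclideanSpace ℝ (Fin m)) M] [IsManifold (𝓡 m) ∞ M]
    [MeasurableSpace M] [BorelSpace M]
    (g : AlphaHarmonic.RiemMetric m M) (α : ℝ) (hα : 1 < α)
    (ψ : M → AlphaHarmonic.Sphere n)
    (hψ : AlphaHarmonic.IsAlphaHarmonic g (AlphaHarmonic.roundMetric n) α ψ)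
    (hconst : ∃ x, mfderiv (𝓡 m) (𝓡 n) ψ x ≠ 0)
    (hbound : ∀ x, AlphaHarmonic.normSqDiff g (AlphaHarmonic.roundMetric n) ψ x
      < ((n : ℝ) - 2) / (2 * α - n)) :
    ¬ AlphaHarmonic.IsStable g (AlphaHarmonic.roundMetric n) α ψ := by
  intro hstab
  have hs := hψ.1
  have hd : ∀ x, MDifferentiableAt (𝓡 m) (𝓡 n) ψ x := hs.mdifferentiable (by simp)
  have hf : ContMDiff (𝓡 m) 𝓘(ℝ, AlphaHarmonic.Euc (n + 1)) ∞
      (fun x => (ψ x : AlphaHarmonic.Euc (n + 1))) :=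
    AlphaHarmonic.contMDiff_sphere_incl.comp hs
  have he := AlphaHarmonic.energyDensity_nonneg g fun x => (ψ x : AlphaHarmonic.Euc (n + 1))
  have hfin := AlphaHarmonic.isFiniteMeasure_riemVolume g
  have hopen : (AlphaHarmonic.riemVolume g).IsOpenPosMeasure :=
    ⟨fun U hU hne => (AlphaHarmonic.riemVolume_pos_of_isOpen g hU hne).ne'⟩
  obtain ⟨x₁, hx₁⟩ := hconst
  obtain ⟨i, hi⟩ := AlphaHarmonic.exists_integral_boostIntegrandDeriv₂_neg
    (AlphaHarmonic.riemVolume g) hα hf.continuous (fun x => norm_eq_of_mem_sphere (ψ x))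
    (AlphaHarmonic.continuous_energyDensity g hf) he
    (fun x => AlphaHarmonic.mul_lt_of_lt_div_of_nonneg hα (he x)
      ((AlphaHarmonic.normSqDiff_eq_energyDensity g (hd x)).symm.trans_lt (hbound x)))
    (AlphaHarmonic.energyDensity_pos g (AlphaHarmonic.ambDeriv_coe_sphere_ne_zero (hd x₁) hx₁))
  have hi' := AlphaHarmonic.norm_stdVec i
  rw [← AlphaHarmonic.secondVariation_boost g α hs hi'] at hi
  exact hi.not_ge (hstab _ (AlphaHarmonic.isVectorFieldAlong_boostField hs hi') 1 _
    (AlphaHarmonic.isVariation₂_boost hs hi'))
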